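/- Let $X=\mathbb R^{k_1}$, $Y=\mathbb R^{k_2}$, $Z\subset X\times Y$, and let $l:Y\times Y\to[0,M]$, $M>0$, be a measurable loss function. Let $\Theta$ be a standard Borel space of network weights (for example a Borel subset of some $\mathbb R^N$) and let $g(x,p;\theta)\in Y$ be a network with input $x\in X$, task parameter $p\in\mathbb R^{d}$ and weights $\theta\in\Theta$, jointly measurable in $(x,p,\theta)$. Put $$\mathcal F=\{x\mapsto (x,p)\mid p\in\mathbb R^{d}\},\qquad \mathcal G=\{(x,p)\mapsto g(x,p;\theta)\mid\theta\in\Theta\},$$ let $\mathcal F^n$ be the set of tuples $\vec f=(f_1,\dots,f_n)$ with $f_i\in\mathcal F$, let $\bar{\mathcal G}=\{(g,\dots,g)\mid g\in\mathcal G\}$, and let $\bar{\mathcal G}\circ\mathcal F^n$ be the set of all $\bar g\circ\vec f=(g\circ f_1,\dots,g\circ f_n)$, $g\in\mathcal G$, $f_i\in\mathcal F$ (all tasks share the weights, each task has its own parameter). For $h$ with values in $Y$ write $l_h(u,y)=l(y,h(u))$ and $l_{\mathcal G}=\{l_g\mid g\in\mathcal G\}$. For a set $A$ with a pseudometric $\rho$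 let $\mathcal N(\varepsilon,A,\rho)$ be the least cardinality of a subset $T\subset A$ such that every $a\in A$ has some $t\in T$ with $\rho(a,t)\le\varepsilon$ (it is $\infty$ if there is no finite such $T$). The capacities are $$\mathcal C(\varepsilon,l_{\mathcal G})=\sup_{Q}\mathcal N(\varepsilon,l_{\mathcal G},d_Q),\quad d_Q(h,h')=\int|h-h'|\,dQ,$$ over all probability measures $Q$ on $\{((x,p),y)\mid (x,y)\in Z,\ p\in\mathbb R^d\}$, and $$\mathcal C_{l_{\mathcal G}}(\varepsilon,\mathcal F)=\sup_{P}\mathcal N(\varepsilon,\mathcal F,d_{[P,l_{\mathcal G}]}),\quad d_{[P,l_{\mathcal G}]}(f,f')=\int\sup_{g\in\mathcal G}\bigl|l_{g\circ f}-l_{g\circ f'}\bigr|\,dP,$$ over all probability measures $P$ on $Z$. Let $P_1,\dots,P_n$ ($n\ge1$) be probability measures on $Z$, and let $\mathbf z=(z_{ij})_{i\le n,\,j\le m}$ be independent samples, $z_{ij}$ distributed according to $P_i$. For $h=(h_1,\dots,h_n)$ put $$\langle l_h\rangle_{\mathbf z}=\frac1n\sum_{i=1}^n\frac1m\sum_{j=1}^m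 l_{h_i}(z_{ij}),\qquad \langle l_h\rangle_{\vec P}=\frac1n\sum_{i=1}^n\int l_{h_i}\,dP_i,\qquad d_\nu(s,t)=\frac{|s-t|}{\nu+s+t}\ \ (s,t\ge 0).$$ **Theorem.** Let $\nu>0$, $0<\alpha<1$, $0<\delta<1$ and $\varepsilon_1,\varepsilon_2>0$ with $\varepsilon_1+\varepsilon_2=\alpha\nu/8$. If $$m>\frac{8M}{\alpha^2\nu}\left[\ln \mathcal C_{l_{\mathcal G}}(\varepsilon_1,\mathcal F)+\frac1n\ln\frac{4\,\mathcal C(\varepsilon_2,l_{\mathcal G})}{\delta}\right]$$ (with $\ln\infty=\infty$), then $$\Pr\Bigl\{\mathbf z:\ \exists\, h\in\bar{\mathcal G}\circ\mathcal F^n:\ d_\nu\bigl(\langle l_h\rangle_{\mathbf z},\langle l_h\rangle_{\vec P}\bigr)>\alpha\Bigr\}\le\delta .$$ -/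

import Mathlib

open MeasureTheory
open scoped ENNReal

/-- Haussler's relative distance `d_ν(x, y) = |x - y| / (ν + x + y)` (used for `ν > 0`, `x, y ≥ 0`). -/
noncomputable def haussler (ν x y : ℝ) : ℝ := |x - y| / (ν + x + y)

section Classes

variable {X V W Y Θ : Type*}

/-- The class `𝓕` of the maps `x ↦ (x, p)`, which append a task parameter `p` to the input. -/
def paramMaps (X W : Type*) : Set (X → X × W) :=
  {f | ∃ p : W, f = fun x => (x, p)}

/-- The class `𝓖` of all networks `v ↦ g(v; θ)` obtained from the weights `θ`. -/
def networkClass (g : V → Θ → Y) : Set (V → Y) :=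
  {h | ∃ θ : Θ, h = fun v => g v θ}

/-- The class `𝓕ⁿ`: tuples `(f₁, …, fₙ)` of members of `F`, acting on `Xⁿ` coordinate by
coordinate. -/
def powClass (n : ℕ) (F : Set (X → V)) : Set (Fin n → X → V) :=
  {f | ∀ i, f i ∈ F}

/-- The class of tuples `(g, …, g)`, where the same `g ∈ G` is used in every coordinate. -/
def diagClass (n : ℕ) (G : Set (V → Y)) : Set (Fin n → V → Y) :=
  {k | ∃ g ∈ G, k = fun _ => g}

/-- All coordinatewise compositions `k ∘ f` with `k ∈ K` and `f ∈ F`. -/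
def compClass {n : ℕ} (K : Set (Fin n → V → Y)) (F : Set (Fin n → X → V)) :
    Set (Fin n → X → Y) :=
  {h | ∃ k ∈ K, ∃ f ∈ F, h = fun i => k i ∘ f i}

/-- The function `l_h(x, y) = l(y, h(x))`. -/
def lossFun (l : Y → Y → ℝ) (h : X → Y) : X × Y → ℝ :=
  fun z => l z.2 (h z.1)

/-- The family `l_H = {l_h : h ∈ H}`. -/
def lossClass (l : Y → Y → ℝ) (H : Set (X → Y)) : Set (X × Y → ℝ) :=
  lossFun l '' H

end Classes

section Losses

variable {X Y : Type*}

/-- The empirical loss of one task: the average of `l(yⱼ, h(xⱼ))` over the samples. -/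
noncomputable def empLoss (l : Y → Y → ℝ) (h : X → Y) {m : ℕ} (z : Fin m → X × Y) : ℝ :=
  (1 / (m : ℝ)) * ∑ j, lossFun l h (z j)

/-- The true loss of one task. -/
noncomputable def trueLoss [MeasurableSpace X] [MeasurableSpace Y]
    (l : Y → Y → ℝ) (h : X → Y) (P : Measure (X × Y)) : ℝ :=
  ∫ z, lossFun l h z ∂P

/-- The multi-task empirical loss: the average of the empirical losses of the tasks. -/
noncomputable def multiEmpLoss (l : Y → Y → ℝ) {n m : ℕ} (h : Fin n → X → Y)
    (z : Fin n → Fin m → X × Y) : ℝ :=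
  (1 / (n : ℝ)) * ∑ i, empLoss l (h i) (z i)

/-- The multi-task true loss: the average of the true losses of the tasks. -/
noncomputable def multiTrueLoss [MeasurableSpace X] [MeasurableSpace Y]
    (l : Y → Y → ℝ) {n : ℕ} (h : Fin n → X → Y) (P : Fin n → Measure (X × Y)) : ℝ :=
  (1 / (n : ℝ)) * ∑ i, trueLoss l (h i) (P i)

end Losses

section Capacities

variable {X V W Y : Type*}

/-- The covering number `𝓝(ε, A, d)`: the least cardinality of a subset `T` of `A` such that every
point of `A` is at distance at most `ε` from a point of `T` (`⊤` if there is no finite one). -/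
noncomputable def coverNumber {E : Type*} (ε : ℝ) (A : Set E) (d : E → E → ℝ≥0∞) : ℕ∞ :=
  ⨅ (T : Set E) (_ : T ⊆ A ∧ ∀ a ∈ A, ∃ t ∈ T, d a t ≤ ENNReal.ofReal ε), T.encard

/-- The `L¹` pseudometric `d_P(h, h') = ∫ |h - h'| dP`. -/
noncomputable def distL1 {S : Type*} [MeasurableSpace S] (P : Measure S) (h h' : S → ℝ) : ℝ≥0∞ :=
  ∫⁻ z, ENNReal.ofReal |h z - h' z| ∂P

/-- The pseudometric `d_{[P, l_𝓖]}(f, f') = ∫ sup_{g ∈ 𝓖} |l(y, g(f x)) - l(y, g(f' x))| dP(x, y)`. -/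
noncomputable def distSup [MeasurableSpace X] [MeasurableSpace Y]
    (l : Y → Y → ℝ) (G : Set (V → Y)) (P : Measure (X × Y)) (f f' : X → V) : ℝ≥0∞ :=
  ∫⁻ z, ⨆ g ∈ G, ENNReal.ofReal |lossFun l (g ∘ f) z - lossFun l (g ∘ f') z| ∂P

/-- The `ε`-capacity `𝓒(ε, H)` of a class of real functions on the sample space `D ⊆ S`: the
supremum of the covering numbers of `(H, d_P)` over all probability measures `P` on `D`. -/
noncomputable def capacity {S : Type*} [MeasurableSpace S] (D : Set S) (ε : ℝ)
    (H : Set (S → ℝ)) : ℕ∞ :=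
  ⨆ (P : Measure S) (_ : IsProbabilityMeasure P ∧ ∀ᵐ z ∂P, z ∈ D), coverNumber ε H (distL1 P)

/-- The `ε`-capacity `𝓒_{l_𝓖}(ε, F)` of a class of maps `X → V`: the supremum of the covering
numbers of `(F, d_{[P, l_𝓖]})` over all probability measures `P` on `Z ⊆ X × Y`. -/
noncomputable def supCapacity [MeasurableSpace X] [MeasurableSpace Y] (Z : Set (X × Y))
    (l : Y → Y → ℝ) (G : Set (V → Y)) (ε : ℝ) (F : Set (X → V)) : ℕ∞ :=
  ⨆ (P : Measure (X × Y)) (_ : IsProbabilityMeasure P ∧ ∀ᵐ z ∂P, z ∈ Z),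
    coverNumber ε F (distSup l G P)

/-- The domain of the functions `((x, p), y) ↦ l(y, g(x, p))` over a sample space `Z ⊆ X × Y`. -/
def extendedDomain (W : Type*) (Z : Set (X × Y)) : Set ((X × W) × Y) :=
  {q | (q.1.1, q.2) ∈ Z}

end Capacities

/-! The proof follows Haussler's argument for relative deviations, with the covering step adapted to
the multi-task class.

Chebyshev's inequality and the triangle inequality for `d_ν` (`haussler_triangle`) show that a
deviation of the sample mean from the true mean by more than `α` is, with probability at least `1/2`,
also a deviation by more than `α/2` from the mean over an independent second sample, which costs a
factor `2`. The distribution of the double sample does not change if the two values at any of the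
`n m` places are exchanged, so it is enough to bound, for a fixed double sample, the fraction of the
`2^(n m)` swap patterns that produce a deviation (`measure_le_of_card_le`). For a single function this
is Hoeffding's inequality (`card_swaps_le`), with the variance `∑ (a - b)²` bounded by `M ∑ (a + b)`;
the relative form of `d_ν` cancels the last sum.

A fixed double sample needs only a finite cover in the empirical `L¹`-distance. It is obtained from
the capacities of `𝓕` (once for each task) and of `l_𝓖` (once for all tasks together), so that it has
at most `C₁ⁿ C₂` members (`exists_finset_taskLoss_cover`). As its radius is `ε₁ + ε₂ = α ν / 8`, a
deviation for some function gives one for a member of the cover, with `ν / 4` in place of `ν`.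
Altogether the probability is at most `4 C₁ⁿ C₂ exp(-α² ν n m / (8 M))`
(`measure_exists_lt_haussler_le`), which is at most `δ` by the choice of `m`.

The supremum over an uncountable class makes the measurability of the events an issue. The first
step holds for outer measures. For the averaging over swaps, the event has to be null-measurable; it
is a projection of a Borel set, hence analytic, and analytic sets are universally measurable
(`MeasureTheory.AnalyticSet.nullMeasurableSet`). -/

/-! ### Measurability of projections -/

/-- Analytic sets are approximated from inside by compact, hence measurable, subsets. If the set is
the continuous image `f(ℕ^ℕ)`, then the coordinates can be bounded one at a time while the outer
measure of the image stays above `r`, and the image of the compact box obtained in the limit still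
has measure at least `r`. -/
theorem MeasureTheory.AnalyticSet.exists_measurableSet_subset_le {α : Type*} [TopologicalSpace α]
    [T2Space α] [MeasurableSpace α] [OpensMeasurableSpace α] {μ : Measure α} [μ.OuterRegular]
    {A : Set α} (hA : AnalyticSet A) {r : ℝ≥0∞} (hr : r < μ A) :
    ∃ K ⊆ A, MeasurableSet K ∧ r ≤ μ K := by
  rw [AnalyticSet] at hA
  rcases hA with rfl | ⟨f, hf, rfl⟩
  · simp at hr
  have step : ∀ (j : ℕ) (s : {s : Set (ℕ → ℕ) // r < μ (f '' s)}),
      ∃ c : ℕ, r < μ (f '' (s.1 ∩ {x | x j ≤ c})) := by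
    rintro j ⟨s, hs⟩
    have hU : f '' s = ⋃ c : ℕ, f '' (s ∩ {x | x j ≤ c}) := by
      rw [← Set.image_iUnion, ← Set.inter_iUnion]
      congr 1
      ext x
      simpa using fun _ => ⟨x j, le_rfl⟩
    have hmono : Monotone fun c : ℕ => f '' (s ∩ {x | x j ≤ c}) := fun c c' h =>
      Set.image_mono (Set.inter_subset_inter_right _ fun x hx => le_trans hx h)
    rw [hU, hmono.measure_iUnion] at hs
    exact lt_iSup_iff.1 hs
  choose c hc using step
  let S : ℕ → {s : Set (ℕ → ℕ) // r < μ (f '' s)} := fun j =>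
    Nat.rec ⟨Set.univ, by rwa [Set.image_univ]⟩ (fun j s => ⟨s.1 ∩ {x | x j ≤ c j s}, hc j s⟩) j
  let k : ℕ → ℕ := fun j => c j (S j)
  have hS : ∀ j, (S j).1 = {x | ∀ i < j, x i ≤ k i} := by
    intro j
    induction j with
    | zero => ext x; simp [S]
    | succ j ih =>
      have : (S (j + 1)).1 = (S j).1 ∩ {x | x j ≤ k j} := rfl
      rw [this, ih]
      ext x
      simp only [Set.mem_inter_iff, Set.mem_ofPred_eq, Nat.forall_lt_succ_right]
  let K : Set (ℕ → ℕ) := Set.univ.pi fun i => Set.Iic (k i)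
  have hK : IsCompact K := isCompact_univ_pi fun i => (Set.finite_Iic (k i)).isCompact
  have hfK : IsCompact (f '' K) := hK.image hf
  refine ⟨f '' K, Set.image_subset_range _ _, hfK.isClosed.measurableSet, ?_⟩
  rw [Set.measure_eq_iInf_isOpen (f '' K) μ]
  refine le_iInf fun U => le_iInf fun hKU => le_iInf fun hU => ?_
  -- some box with finitely many bounded coordinates is already mapped into `U`
  have hj : ∃ j, (S j).1 ⊆ f ⁻¹' U := by
    by_contra! hcon
    simp only [Set.not_subset] at hcon
    choose x hxS hxU using hcon
    obtain ⟨a, haK, φ, hφ, hlim⟩ := hK.tendsto_subseq (x := fun j i => min (x j i) (k i))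
      fun j i _ => Set.mem_Iic.2 (min_le_right _ _)
    have hlim' : Filter.Tendsto (x ∘ φ) Filter.atTop (nhds a) := by
      rw [tendsto_pi_nhds] at hlim ⊢
      intro i
      refine (hlim i).congr' ?_
      filter_upwards [Filter.eventually_gt_atTop i] with j hj
      have h := hxS (φ j)
      rw [hS] at h
      exact min_eq_left (h i (hj.trans_le (hφ.id_le j)))
    have haU : a ∈ f ⁻¹' U := hKU ⟨a, haK, rfl⟩
    obtain ⟨j, hj⟩ := (hlim'.eventually ((hU.preimage hf).mem_nhds haU)).exists
    exact hxU _ hj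
  obtain ⟨j, hj⟩ := hj
  exact (S j).2.le.trans (measure_mono (Set.image_subset_iff.2 hj))

/-- Analytic sets are universally measurable. -/
theorem MeasureTheory.AnalyticSet.nullMeasurableSet {α : Type*} [TopologicalSpace α]
    [T2Space α] [MeasurableSpace α] [OpensMeasurableSpace α] {μ : Measure α} [IsFiniteMeasure μ]
    [μ.OuterRegular] {A : Set α} (hA : AnalyticSet A) : NullMeasurableSet A μ := by
  rcases eq_or_ne (μ A) 0 with h0 | h0
  · exact NullMeasurableSet.of_null h0
  obtain ⟨u, -, hu, hlim⟩ := exists_seq_strictMono_tendsto' (pos_iff_ne_zero.2 h0)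
  choose K hKA hK hle using fun j => hA.exists_measurableSet_subset_le (hu j).2
  have hUA : ⋃ j, K j ⊆ A := Set.iUnion_subset hKA
  have hU : MeasurableSet (⋃ j, K j) := .iUnion hK
  have hge : μ A ≤ μ (⋃ j, K j) :=
    le_of_tendsto' hlim fun j => (hle j).trans (measure_mono (Set.subset_iUnion K j))
  exact hU.nullMeasurableSet.congr
    (ae_eq_of_subset_of_measure_ge hUA hge hU.nullMeasurableSet (measure_ne_top _ _))

/-- The measurable projection theorem. -/
theorem nullMeasurableSet_setOf_exists {α β : Type*} [MeasurableSpace α] [StandardBorelSpace α]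
    [MeasurableSpace β] [StandardBorelSpace β] {s : Set (α × β)} (hs : MeasurableSet s)
    (μ : Measure α) [IsFiniteMeasure μ] : NullMeasurableSet {a | ∃ b, (a, b) ∈ s} μ := by
  let := upgradeStandardBorel α
  have : {a | ∃ b, (a, b) ∈ s} = Prod.fst '' s := by ext; simp
  rw [this]
  exact (hs.analyticSet_image measurable_fst).nullMeasurableSet

/-! ### The relative distance -/

theorem lt_haussler_iff {ν a b α : ℝ} (hν : 0 < ν) (ha : 0 ≤ a) (hb : 0 ≤ b) :
    α < haussler ν a b ↔ α * (ν + a + b) < |a - b| :=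
  lt_div_iff₀ (by positivity)

theorem haussler_comm (ν a b : ℝ) : haussler ν a b = haussler ν b a := by
  rw [haussler, haussler, abs_sub_comm, add_right_comm]

/-- With `a' = a + ν/2` and so on, `d_ν(a, b) = |a' - b'| / (a' + b')` is the hyperbolic tangent of
half the distance of `log a'` and `log b'`, and `tanh` is subadditive. -/
theorem haussler_triangle {ν a b c : ℝ} (hν : 0 < ν) (ha : 0 ≤ a) (hb : 0 ≤ b) (hc : 0 ≤ c) :
    haussler ν a c ≤ haussler ν a b + haussler ν b c := by
  wlog hac : a ≤ c generalizing a c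
  · have := this hc ha (not_le.1 hac).le
    rw [haussler_comm ν a c, haussler_comm ν a b, haussler_comm ν b c]
    linarith
  have hnn : ∀ {x y : ℝ}, 0 ≤ x → 0 ≤ y → 0 ≤ haussler ν x y := fun hx hy =>
    div_nonneg (abs_nonneg _) (by positivity)
  rcases lt_or_ge b a with hba | hab
  · refine le_add_of_nonneg_of_le (hnn ha hb) ?_
    rw [haussler, haussler, abs_of_nonpos (by linarith), abs_of_nonpos (by linarith)]
    gcongr
    linarith
  rcases lt_or_ge c b with hcb | hbc
  · refine le_add_of_le_of_nonneg ?_ (hnn hb hc)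
    rw [haussler, haussler, abs_of_nonpos (by linarith), abs_of_nonpos (by linarith),
      div_le_div_iff₀ (by positivity) (by positivity)]
    nlinarith [mul_nonneg (sub_nonneg.2 hcb.le) (by positivity : 0 ≤ ν + 2 * a)]
  · rw [haussler, haussler, haussler, abs_of_nonpos (by linarith), abs_of_nonpos (by linarith),
      abs_of_nonpos (by linarith), div_add_div _ _ (by positivity) (by positivity),
      div_le_div_iff₀ (by positivity) (by positivity)]
    have := mul_nonneg (mul_nonneg (sub_nonneg.2 hab) (sub_nonneg.2 hbc)) (sub_nonneg.2 hac)
    linarith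

/-- A deviation of two means survives an approximation of the means with total error `α ν / 4`, if
`ν` is replaced by `ν / 4`. -/
theorem lt_abs_sub_of_approx {ν α s t s' t' : ℝ} (hν : 0 < ν) (hα₀ : 0 < α) (hα₁ : α < 1)
    (happ : |s - s'| + |t - t'| ≤ α * ν / 4) (h : α / 2 * (ν + s + t) < |s - t|) :
    α / 2 * (ν / 4 + s' + t') < |s' - t'| := by
  have h1 : |s - t| ≤ |s' - t'| + (|s - s'| + |t - t'|) := by
    have h2 := abs_sub_le s s' t
    have h3 := abs_sub_le s' t' t
    rw [abs_sub_comm t' t] at h3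
    linarith
  have h4 : s' + t' ≤ s + t + α * ν / 4 := by
    have h2 := neg_abs_le (s - s')
    have h3 := neg_abs_le (t - t')
    linarith
  have h5 : α / 2 * (s' + t') ≤ α / 2 * (s + t + α * ν / 4) := by gcongr
  nlinarith [mul_pos (mul_pos hα₀ hν) (sub_pos.2 hα₁)]

/-! ### Random swaps -/

section Swaps

variable {ι : Type*} [Fintype ι]

/-- The exponential moment method for a Rademacher sum, as a count of sign patterns. -/
theorem card_signs_mul_exp_le [DecidableEq ι] (c : ι → ℝ) {lam : ℝ} (hl : 0 ≤ lam) (T : ℝ) :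
    (Finset.card {σ : ι → Bool | T < ∑ i, (if σ i then -c i else c i)} : ℝ) * Real.exp (lam * T) ≤
      2 ^ Fintype.card ι * Real.exp (lam ^ 2 * (∑ i, c i ^ 2) / 2) := by
  calc (Finset.card {σ : ι → Bool | T < ∑ i, (if σ i then -c i else c i)} : ℝ) * Real.exp (lam * T)
      = ∑ σ : ι → Bool with T < ∑ i, (if σ i then -c i else c i), Real.exp (lam * T) := by simp
    _ ≤ ∑ σ : ι → Bool with T < ∑ i, (if σ i then -c i else c i),
          Real.exp (lam * ∑ i, (if σ i then -c i else c i)) := by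
        refine Finset.sum_le_sum fun σ hσ => ?_
        rw [Finset.mem_filter] at hσ
        gcongr
        exact hσ.2.le
    _ ≤ ∑ σ : ι → Bool, Real.exp (lam * ∑ i, (if σ i then -c i else c i)) :=
        Finset.sum_le_sum_of_subset_of_nonneg (Finset.filter_subset _ _) fun _ _ _ => by positivity
    _ = ∏ i, ∑ b : Bool, Real.exp (lam * (if b then -c i else c i)) := by
        rw [Finset.prod_univ_sum, Fintype.piFinset_univ]
        refine Finset.sum_congr rfl fun σ _ => ?_
        rw [Finset.mul_sum, Real.exp_sum]
    _ = ∏ i, (2 * Real.cosh (lam * c i)) := by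
        refine Finset.prod_congr rfl fun i _ => ?_
        rw [Real.cosh_eq]
        simp
        ring_nf
    _ ≤ ∏ i, (2 * Real.exp ((lam * c i) ^ 2 / 2)) := by
        refine Finset.prod_le_prod (fun i _ => ?_) fun i _ => ?_
        · have := Real.cosh_pos (lam * c i)
          positivity
        · gcongr
          exact Real.cosh_le_exp_half_sq _
    _ = 2 ^ Fintype.card ι * Real.exp (lam ^ 2 * (∑ i, c i ^ 2) / 2) := by
        rw [Finset.prod_mul_distrib, ← Real.exp_sum, Finset.prod_const, Finset.card_univ,
          Finset.mul_sum, Finset.sum_div]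
        simp only [mul_pow]

/-- Hoeffding's inequality for the difference of two samples with values in `[0, M]`, each pair of
which is swapped with probability `1/2`, relative to the sum of all values (which is not changed by
swaps). -/
theorem card_swaps_le [DecidableEq ι] {a b : ι → ℝ} {M β κ : ℝ} (hM : 0 < M) (hβ : 0 ≤ β)
    (ha : ∀ i, a i ∈ Set.Icc 0 M) (hb : ∀ i, b i ∈ Set.Icc 0 M) :
    (Finset.card {σ : ι → Bool | β * (κ + ∑ i, (a i + b i)) <
        |∑ i, (if σ i then -(a i - b i) else a i - b i)|} : ℝ) ≤
      2 * 2 ^ Fintype.card ι * Real.exp (-(2 * β ^ 2 * κ / M)) := by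
  have key : ∀ c : ι → ℝ, (∀ i, c i ^ 2 ≤ M * (a i + b i)) →
      (Finset.card {σ : ι → Bool | β * (κ + ∑ i, (a i + b i)) <
        ∑ i, (if σ i then -c i else c i)} : ℝ) ≤
      2 ^ Fintype.card ι * Real.exp (-(2 * β ^ 2 * κ / M)) := by
    intro c hc
    -- this exponent is optimal when `κ` equals the sum, and good enough in all cases
    have h := card_signs_mul_exp_le c (lam := 2 * β / M) (by positivity)
      (β * (κ + ∑ i, (a i + b i)))
    have hsum : ∑ i, c i ^ 2 ≤ M * ∑ i, (a i + b i) := by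
      rw [Finset.mul_sum]
      exact Finset.sum_le_sum fun i _ => hc i
    refine le_of_mul_le_mul_right (h.trans ?_)
      (Real.exp_pos (2 * β / M * (β * (κ + ∑ i, (a i + b i)))))
    rw [mul_assoc, ← Real.exp_add]
    gcongr
    calc (2 * β / M) ^ 2 * (∑ i, c i ^ 2) / 2
        ≤ (2 * β / M) ^ 2 * (M * ∑ i, (a i + b i)) / 2 := by gcongr
      _ = _ := by
        field_simp
        ring
  have hsq : ∀ i, (a i - b i) ^ 2 ≤ M * (a i + b i) := fun i => by
    obtain ⟨h1, h2⟩ := ha i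
    obtain ⟨h3, h4⟩ := hb i
    nlinarith [mul_nonneg h1 (sub_nonneg.2 h2), mul_nonneg h3 (sub_nonneg.2 h4), mul_nonneg h1 h3]
  have h1 := key (fun i => a i - b i) hsq
  have h2 := key (fun i => -(a i - b i)) fun i => by rw [neg_sq]; exact hsq i
  have hsub : ({σ : ι → Bool | β * (κ + ∑ i, (a i + b i)) <
        |∑ i, (if σ i then -(a i - b i) else a i - b i)|} : Finset (ι → Bool)) ⊆
      ({σ : ι → Bool | β * (κ + ∑ i, (a i + b i)) <
        ∑ i, (if σ i then -(a i - b i) else a i - b i)} : Finset (ι → Bool)) ∪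
      ({σ : ι → Bool | β * (κ + ∑ i, (a i + b i)) <
        ∑ i, (if σ i then -(-(a i - b i)) else -(a i - b i))} : Finset (ι → Bool)) := by
    intro σ hσ
    simp only [Finset.mem_union, Finset.mem_filter, Finset.mem_univ, true_and] at hσ ⊢
    rw [lt_abs, ← Finset.sum_neg_distrib] at hσ
    refine hσ.imp_right fun h => h.trans_eq (Finset.sum_congr rfl fun i _ => ?_)
    split_ifs <;> rfl
  have h3 := (Finset.card_le_card hsub).trans (Finset.card_union_le _ _)
  have h4 := (Nat.cast_le (α := ℝ)).2 h3
  push_cast at h4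
  linarith

end Swaps

/-! ### Symmetrization -/

/-- Comparison with a second sample. It holds for outer measures, since the measurable hull of `B`
can replace `B`. -/
theorem measure_le_two_mul_prod {Ω Ω' : Type*} [MeasurableSpace Ω] [MeasurableSpace Ω']
    (μ : Measure Ω) (μ' : Measure Ω') [SFinite μ'] {A : Set Ω} {B : Set (Ω × Ω')}
    (h : ∀ z ∈ A, 2⁻¹ ≤ μ' {z' | (z, z') ∈ B}) : μ A ≤ 2 * μ.prod μ' B := by
  have hB := measurableSet_toMeasurable (μ.prod μ') B
  have hA : A ⊆ {z | 2⁻¹ ≤ μ' (Prod.mk z ⁻¹' toMeasurable (μ.prod μ') B)} := fun z hz =>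
    (h z hz).trans (measure_mono fun z' hz' => subset_toMeasurable _ _ hz')
  rw [← measure_toMeasurable (s := B), Measure.prod_apply hB]
  calc μ A = 2 * (2⁻¹ * μ A) := by
        rw [← mul_assoc, ENNReal.mul_inv_cancel two_ne_zero ENNReal.ofNat_ne_top, one_mul]
    _ ≤ 2 * ∫⁻ z, μ' (Prod.mk z ⁻¹' toMeasurable (μ.prod μ') B) ∂μ := by
        gcongr
        exact (mul_le_mul_right (measure_mono hA) _).trans
          (mul_meas_ge_le_lintegral (measurable_measure_prodMk_left hB) _)

/-- If every point is moved into `B` by at most the fraction `c` of a finite family of measure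
preserving maps, then `B` has measure at most `c`. -/
theorem measure_le_of_card_le {Ω Γ : Type*} [MeasurableSpace Ω] [Fintype Γ] [Nonempty Γ]
    {ρ : Measure Ω} [IsProbabilityMeasure ρ] {T : Γ → Ω → Ω} (hT : ∀ σ, MeasurePreserving (T σ) ρ ρ)
    {B : Set Ω} (hB : NullMeasurableSet B ρ) {c : ℝ} [∀ w, DecidablePred fun σ => T σ w ∈ B]
    (h : ∀ᵐ w ∂ρ, (Finset.card {σ | T σ w ∈ B} : ℝ) ≤ c * Fintype.card Γ) :
    ρ B ≤ ENNReal.ofReal c := by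
  have hpre : ∀ σ, NullMeasurableSet (T σ ⁻¹' B) ρ := fun σ =>
    hB.preimage (hT σ).quasiMeasurePreserving
  have hcard : (Fintype.card Γ : ℝ≥0∞) ≠ 0 := by simp
  have key : (Fintype.card Γ : ℝ≥0∞) * ρ B ≤ Fintype.card Γ * ENNReal.ofReal c := by
    calc (Fintype.card Γ : ℝ≥0∞) * ρ B = ∑ σ : Γ, ρ (T σ ⁻¹' B) := by
          simp [fun σ => (hT σ).measure_preimage hB]
      _ = ∫⁻ w, ∑ σ : Γ, (T σ ⁻¹' B).indicator (fun _ => (1 : ℝ≥0∞)) w ∂ρ := by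
          rw [lintegral_finsetSum' _ fun σ _ => aemeasurable_const.indicator₀ (hpre σ)]
          simp [lintegral_indicator_const₀ (hpre _)]
      _ ≤ ∫⁻ _, ENNReal.ofReal (c * Fintype.card Γ) ∂ρ := by
          refine lintegral_mono_ae (h.mono fun w hw => ?_)
          have : ∑ σ : Γ, (T σ ⁻¹' B).indicator (fun _ => (1 : ℝ≥0∞)) w =
              ENNReal.ofReal (Finset.card {σ | T σ w ∈ B} : ℝ) := by
            rw [ENNReal.ofReal_natCast, Finset.card_filter, Nat.cast_sum]
            refine Finset.sum_congr rfl fun σ _ => ?_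
            by_cases hσ : T σ w ∈ B <;> simp [hσ]
          rw [this]
          exact ENNReal.ofReal_le_ofReal hw
      _ = Fintype.card Γ * ENNReal.ofReal c := by
          rw [lintegral_const, measure_univ, mul_one, ENNReal.ofReal_mul' (Nat.cast_nonneg _),
            ENNReal.ofReal_natCast, mul_comm]
  exact (ENNReal.mul_le_mul_iff_right hcard (ENNReal.natCast_ne_top _)).1 key

/-! ### Samples of several tasks -/

section Samples

variable {S : Type*} {n m : ℕ}

/-- The average over the tasks of the sample means of `φ₁, …, φₙ`. -/
noncomputable def sampleMean (φ : Fin n → S → ℝ) (z : Fin n → Fin m → S) : ℝ :=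
  (1 / (n : ℝ)) * ∑ i, (1 / (m : ℝ)) * ∑ j, φ i (z i j)

/-- The average over the tasks of the expectations of `φ₁, …, φₙ`. -/
noncomputable def trueMean [MeasurableSpace S] (φ : Fin n → S → ℝ) (P : Fin n → Measure S) : ℝ :=
  (1 / (n : ℝ)) * ∑ i, ∫ s, φ i s ∂P i

/-- The double sample `w` with its members at the places `(i, j)`, `σ (i, j) = true`, exchanged. -/
def swapSample (σ : Fin n × Fin m → Bool) (w : (Fin n → Fin m → S) × (Fin n → Fin m → S)) :
    (Fin n → Fin m → S) × (Fin n → Fin m → S) :=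
  (fun i j => if σ (i, j) then w.2 i j else w.1 i j,
    fun i j => if σ (i, j) then w.1 i j else w.2 i j)

theorem sampleMean_eq (φ : Fin n → S → ℝ) (z : Fin n → Fin m → S) :
    sampleMean φ z = (∑ q : Fin n × Fin m, φ q.1 (z q.1 q.2)) / (n * m) := by
  rw [sampleMean, Fintype.sum_prod_type, ← Finset.mul_sum]
  field_simp

theorem sampleMean_nonneg {φ : Fin n → S → ℝ} (hφ : ∀ i s, 0 ≤ φ i s) (z : Fin n → Fin m → S) :
    0 ≤ sampleMean φ z := by
  rw [sampleMean_eq]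
  exact div_nonneg (Finset.sum_nonneg fun q _ => hφ _ _) (by positivity)

theorem trueMean_nonneg [MeasurableSpace S] {φ : Fin n → S → ℝ} (hφ : ∀ i s, 0 ≤ φ i s)
    (P : Fin n → Measure S) : 0 ≤ trueMean φ P :=
  mul_nonneg (by positivity) (Finset.sum_nonneg fun i _ => integral_nonneg (hφ i))

theorem abs_sampleMean_sub_le (φ ψ : Fin n → S → ℝ) (z : Fin n → Fin m → S) :
    |sampleMean φ z - sampleMean ψ z| ≤
      (∑ q : Fin n × Fin m, |φ q.1 (z q.1 q.2) - ψ q.1 (z q.1 q.2)|) / (n * m) := by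
  rw [sampleMean_eq, sampleMean_eq, ← sub_div, ← Finset.sum_sub_distrib, abs_div,
    abs_of_nonneg (by positivity : (0 : ℝ) ≤ n * m)]
  gcongr
  exact Finset.abs_sum_le_sum_abs _ _

/-- Sums over both halves of a double sample do not change under swaps. -/
theorem sum_swapSample (F : Fin n → S → ℝ) (σ : Fin n × Fin m → Bool)
    (w : (Fin n → Fin m → S) × (Fin n → Fin m → S)) :
    ∑ q : Fin n × Fin m, (F q.1 ((swapSample σ w).1 q.1 q.2) + F q.1 ((swapSample σ w).2 q.1 q.2)) =
      ∑ q : Fin n × Fin m, (F q.1 (w.1 q.1 q.2) + F q.1 (w.2 q.1 q.2)) := by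
  refine Finset.sum_congr rfl fun q _ => ?_
  by_cases h : σ q
  · simp [swapSample, h, add_comm]
  · simp [swapSample, h]

theorem sampleMean_swapSample_sub (φ : Fin n → S → ℝ) (σ : Fin n × Fin m → Bool)
    (w : (Fin n → Fin m → S) × (Fin n → Fin m → S)) :
    sampleMean φ (swapSample σ w).1 - sampleMean φ (swapSample σ w).2 =
      (∑ q : Fin n × Fin m, (if σ q then -(φ q.1 (w.1 q.1 q.2) - φ q.1 (w.2 q.1 q.2))
        else φ q.1 (w.1 q.1 q.2) - φ q.1 (w.2 q.1 q.2))) / (n * m) := by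
  rw [sampleMean_eq, sampleMean_eq, ← sub_div, ← Finset.sum_sub_distrib]
  congr 1
  refine Finset.sum_congr rfl fun q _ => ?_
  by_cases h : σ q
  · simp [swapSample, h]
  · simp [swapSample, h]

end Samples

section SampleMeasures

variable {S : Type*} [MeasurableSpace S] {n m : ℕ}

/-- Measure preserving maps of the squares of the factors act on the square of a product. -/
theorem measurePreserving_pi_prod {ι : Type*} [Fintype ι] (μ : ι → Measure S)
    [∀ i, SigmaFinite (μ i)] {e : ι → S × S → S × S}
    (he : ∀ i, MeasurePreserving (e i) ((μ i).prod (μ i)) ((μ i).prod (μ i))) :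
    MeasurePreserving (fun w : (ι → S) × (ι → S) =>
        ((fun i => (e i (w.1 i, w.2 i)).1), fun i => (e i (w.1 i, w.2 i)).2))
      ((Measure.pi μ).prod (Measure.pi μ)) ((Measure.pi μ).prod (Measure.pi μ)) := by
  have h1 := measurePreserving_arrowProdEquivProdArrow S S ι μ μ
  exact (h1.comp (measurePreserving_pi _ _ he)).comp (h1.symm _)

theorem measurePreserving_swapSample (P : Fin n → Measure S) [∀ i, IsProbabilityMeasure (P i)]
    (σ : Fin n × Fin m → Bool) :
    MeasurePreserving (swapSample σ)
      ((Measure.pi fun i => Measure.pi fun _ : Fin m => P i).prod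
        (Measure.pi fun i => Measure.pi fun _ : Fin m => P i))
      ((Measure.pi fun i => Measure.pi fun _ : Fin m => P i).prod
        (Measure.pi fun i => Measure.pi fun _ : Fin m => P i)) := by
  have h0 : ∀ i j, MeasurePreserving (fun s : S × S => if σ (i, j) then s.swap else s)
      ((P i).prod (P i)) ((P i).prod (P i)) := fun i j => by
    by_cases h : σ (i, j)
    · simpa [h] using (Measure.measurePreserving_swap (μ := P i) (ν := P i))
    · simpa [h] using! MeasurePreserving.id ((P i).prod (P i))
  have h1 := measurePreserving_pi_prod (fun i => Measure.pi fun _ : Fin m => P i)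
    fun i => measurePreserving_pi_prod (fun _ : Fin m => P i) (h0 i)
  convert h1 using 1
  ext w i j
  · by_cases h : σ (i, j) <;> simp [swapSample, h]
  · by_cases h : σ (i, j) <;> simp [swapSample, h]

theorem memLp_of_mem_Icc {Ω : Type*} [MeasurableSpace Ω] {μ : Measure Ω} [IsFiniteMeasure μ]
    {f : Ω → ℝ} {M : ℝ} (hf : Measurable f) (hfM : ∀ x, f x ∈ Set.Icc 0 M) (p : ℝ≥0∞) :
    MemLp f p μ :=
  MemLp.of_bound hf.aestronglyMeasurable M (.of_forall fun x => by
    rw [Real.norm_of_nonneg (hfM x).1]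
    exact (hfM x).2)

open ProbabilityTheory

theorem variance_le_mul_integral {Ω : Type*} [MeasurableSpace Ω] {μ : Measure Ω}
    [IsProbabilityMeasure μ] {f : Ω → ℝ} {M : ℝ} (hf : Measurable f)
    (hfM : ∀ x, f x ∈ Set.Icc 0 M) : Var[f; μ] ≤ M * ∫ x, f x ∂μ := by
  refine (variance_le_expectation_sq hf.aestronglyMeasurable).trans ?_
  rw [← integral_const_mul]
  refine integral_mono (memLp_of_mem_Icc hf hfM 2).integrable_sq
    ((memLp_one_iff_integrable.1 (memLp_of_mem_Icc hf hfM 1)).const_mul M) fun x => ?_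
  obtain ⟨h0, h1⟩ := hfM x
  simp only [Pi.pow_apply]
  nlinarith

/-- Chebyshev's inequality for the mean of a multi-task sample. -/
theorem measure_le_abs_sampleMean_sub (hn : 0 < n) (hm : 0 < m) (P : Fin n → Measure S)
    [∀ i, IsProbabilityMeasure (P i)] {φ : Fin n → S → ℝ} {M : ℝ} (hφ : ∀ i, Measurable (φ i))
    (hφM : ∀ i s, φ i s ∈ Set.Icc 0 M) {c : ℝ} (hc : 0 < c) :
    Measure.pi (fun i => Measure.pi fun _ : Fin m => P i)
        {z | c ≤ |sampleMean φ z - trueMean φ P|} ≤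
      ENNReal.ofReal (M * trueMean φ P / (n * m) / c ^ 2) := by
  have hn' : (n : ℝ) ≠ 0 := by positivity
  have hm' : (m : ℝ) ≠ 0 := by positivity
  let Y : Fin n → (Fin m → S) → ℝ := fun i x => ∑ j, (1 / ((n : ℝ) * m)) * φ i (x j)
  have hLp : ∀ i, MemLp (φ i) 2 (P i) := fun i => memLp_of_mem_Icc (hφ i) (hφM i) 2
  have hLp' : ∀ i (j : Fin m), MemLp (fun x : Fin m → S => (1 / ((n : ℝ) * m)) * φ i (x j)) 2
      (Measure.pi fun _ : Fin m => P i) := fun i j =>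
    ((hLp i).comp_measurePreserving
      (measurePreserving_eval (fun _ : Fin m => P i) j)).const_mul _
  have hY : ∀ i, MemLp (Y i) 2 (Measure.pi fun _ : Fin m => P i) := fun i =>
    memLp_finsetSum Finset.univ fun j _ => hLp' i j
  have hX : sampleMean φ = ∑ i, fun z : Fin n → Fin m → S => Y i (z i) := by
    ext z
    rw [sampleMean_eq, Fintype.sum_prod_type, Finset.sum_apply]
    simp only [Y, ← Finset.mul_sum]
    ring
  have hYX : ∀ i, MemLp (fun z : Fin n → Fin m → S => Y i (z i)) 2
      (Measure.pi fun i => Measure.pi fun _ : Fin m => P i) := fun i =>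
    (hY i).comp_measurePreserving
      (measurePreserving_eval (fun i => Measure.pi fun _ : Fin m => P i) i)
  have hXLp : MemLp (sampleMean φ) 2 (Measure.pi fun i => Measure.pi fun _ : Fin m => P i) := by
    rw [hX]
    exact memLp_finsetSum' Finset.univ fun i _ => hYX i
  have hint : ∫ z, sampleMean φ z ∂(Measure.pi fun i => Measure.pi fun _ : Fin m => P i) =
      trueMean φ P := by
    rw [hX]
    simp only [Finset.sum_apply]
    rw [integral_finsetSum _ fun i _ => (hYX i).integrable one_le_two, trueMean, Finset.mul_sum]
    refine Finset.sum_congr rfl fun i _ => ?_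
    rw [integral_comp_eval (μ := fun i => Measure.pi fun _ : Fin m => P i)
      (hY i).aestronglyMeasurable]
    simp only [Y]
    rw [integral_finsetSum _ fun j _ => (hLp' i j).integrable one_le_two]
    have : ∀ j : Fin m, ∫ x, 1 / ((n : ℝ) * m) * φ i (x j) ∂(Measure.pi fun _ : Fin m => P i) =
        1 / ((n : ℝ) * m) * ∫ s, φ i s ∂P i := fun j => by
      rw [integral_const_mul, integral_comp_eval (μ := fun _ : Fin m => P i)
        (hLp i).aestronglyMeasurable]
    simp only [this, Finset.sum_const, Finset.card_univ, Fintype.card_fin, nsmul_eq_mul]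
    field_simp
  have hvarY : ∀ i, Var[Y i; Measure.pi fun _ : Fin m => P i] ≤
      M * (1 / n * ∫ s, φ i s ∂P i) / (n * m) := by
    intro i
    have h1 : Y i = ∑ j, fun x : Fin m → S => 1 / ((n : ℝ) * m) * φ i (x j) := by
      ext x
      simp [Y]
    rw [h1, variance_sum_pi (μ := fun _ : Fin m => P i)
      (X := fun _ s => 1 / ((n : ℝ) * m) * φ i s) fun _ => (hLp i).const_mul _]
    simp only [variance_const_mul, Finset.sum_const, Finset.card_univ, Fintype.card_fin,
      nsmul_eq_mul]
    calc (m : ℝ) * ((1 / ((n : ℝ) * m)) ^ 2 * Var[φ i; P i])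
        ≤ (m : ℝ) * ((1 / ((n : ℝ) * m)) ^ 2 * (M * ∫ s, φ i s ∂P i)) := by
          gcongr
          exact variance_le_mul_integral (hφ i) (hφM i)
      _ = _ := by field_simp
  have hvar : Var[sampleMean φ; Measure.pi fun i => Measure.pi fun _ : Fin m => P i] ≤
      M * trueMean φ P / (n * m) := by
    rw [hX, variance_sum_pi hY, trueMean, Finset.mul_sum, Finset.mul_sum, Finset.sum_div]
    exact Finset.sum_le_sum fun i _ => hvarY i
  have h := meas_ge_le_variance_div_sq hXLp hc
  rw [hint] at h
  refine h.trans (ENNReal.ofReal_le_ofReal ?_)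
  gcongr

end SampleMeasures

/-! ### Uniform deviations for classes with small empirical covers -/

theorem measurable_sampleMean_uncurry {S T : Type*} [MeasurableSpace S] [MeasurableSpace T]
    {n m : ℕ} {φ : T → Fin n → S → ℝ} (hφ : ∀ i, Measurable fun q : T × S => φ q.1 i q.2) :
    Measurable fun q : T × (Fin n → Fin m → S) => sampleMean (φ q.1) q.2 := by
  refine .const_mul (Finset.measurable_fun_sum _ fun i _ => .const_mul
    (Finset.measurable_fun_sum _ fun j _ => ?_) _) _
  exact (hφ i).comp (measurable_fst.prodMk
    ((measurable_pi_apply j).comp ((measurable_pi_apply i).comp measurable_snd)))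

theorem measurable_haussler {Ω : Type*} [MeasurableSpace Ω] (ν : ℝ) {f g : Ω → ℝ}
    (hf : Measurable f) (hg : Measurable g) : Measurable fun x => haussler ν (f x) (g x) := by
  unfold haussler
  exact (hf.sub hg).abs.div ((hf.const_add ν).add hg)

/-- The double samples on which the two sample means of some member of the family differ much form
an analytic set. -/
theorem nullMeasurableSet_exists_lt_haussler {S T : Type*} [MeasurableSpace S]
    [StandardBorelSpace S] [MeasurableSpace T] [StandardBorelSpace T] {n m : ℕ}
    {φ : T → Fin n → S → ℝ} (hφ : ∀ i, Measurable fun q : T × S => φ q.1 i q.2) (ν β : ℝ)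
    (ρ : Measure ((Fin n → Fin m → S) × (Fin n → Fin m → S))) [IsFiniteMeasure ρ] :
    NullMeasurableSet
      {w | ∃ t, β < haussler ν (sampleMean (φ t) w.1) (sampleMean (φ t) w.2)} ρ := by
  have hmeas := measurable_sampleMean_uncurry (m := m) hφ
  have h1 : Measurable fun q : ((Fin n → Fin m → S) × (Fin n → Fin m → S)) × T =>
      (q.2, q.1.1) := by fun_prop
  have h2 : Measurable fun q : ((Fin n → Fin m → S) × (Fin n → Fin m → S)) × T =>
      (q.2, q.1.2) := by fun_prop
  have hs := measurableSet_lt (measurable_const (a := β))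
    (measurable_haussler ν (hmeas.comp h1) (hmeas.comp h2))
  exact nullMeasurableSet_setOf_exists hs ρ

/-- If a jointly measurable family `φ t` with values in `[0, M]` admits, on almost every double
sample, an empirical `L¹`-cover with radius `α ν / 8` and at most `K` members, then the
multi-task sample means deviate uniformly little from the expectations. -/
theorem measure_exists_lt_haussler_le {S T : Type*} [MeasurableSpace S] [StandardBorelSpace S]
    [MeasurableSpace T] [StandardBorelSpace T] {n m : ℕ} (hn : 0 < n) (hm : 0 < m)
    (P : Fin n → Measure S) [∀ i, IsProbabilityMeasure (P i)] {φ : T → Fin n → S → ℝ}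
    (hφ : ∀ i, Measurable fun q : T × S => φ q.1 i q.2) {M ν α : ℝ} (hM : 0 < M)
    (hφM : ∀ t i s, φ t i s ∈ Set.Icc 0 M) (hν : 0 < ν) (hα₀ : 0 < α) (hα₁ : α < 1)
    (hnm : 2 * M / (α ^ 2 * ν) ≤ n * m) {K : ℕ}
    (hcover : ∀ᵐ w ∂((Measure.pi fun i => Measure.pi fun _ : Fin m => P i).prod
        (Measure.pi fun i => Measure.pi fun _ : Fin m => P i)),
      ∃ F : Finset T, F.card ≤ K ∧ ∀ t, ∃ t' ∈ F, ∑ q : Fin n × Fin m,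
        (|φ t q.1 (w.1 q.1 q.2) - φ t' q.1 (w.1 q.1 q.2)| +
          |φ t q.1 (w.2 q.1 q.2) - φ t' q.1 (w.2 q.1 q.2)|) ≤ n * m * (α * ν / 4)) :
    Measure.pi (fun i => Measure.pi fun _ : Fin m => P i)
        {z | ∃ t, α < haussler ν (sampleMean (φ t) z) (trueMean (φ t) P)} ≤
      ENNReal.ofReal (4 * K * Real.exp (-(α ^ 2 * ν * (n * m) / (8 * M)))) := by
  classical
  have hN : (0 : ℝ) < n * m := by positivity
  have hφ' : ∀ t i, Measurable (φ t i) := fun t i => (hφ i).comp measurable_prodMk_left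
  have hmean : ∀ t (z : Fin n → Fin m → S), 0 ≤ sampleMean (φ t) z := fun t =>
    sampleMean_nonneg fun i s => (hφM t i s).1
  have htrue : ∀ t, 0 ≤ trueMean (φ t) P := fun t => trueMean_nonneg (fun i s => (hφM t i s).1) P
  set μ := Measure.pi (fun i => Measure.pi fun _ : Fin m => P i) with hμ
  let B : Set ((Fin n → Fin m → S) × (Fin n → Fin m → S)) :=
    {w | ∃ t, α / 2 < haussler ν (sampleMean (φ t) w.1) (sampleMean (φ t) w.2)}
  have hB : NullMeasurableSet B (μ.prod μ) :=
    nullMeasurableSet_exists_lt_haussler hφ ν (α / 2) _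
  -- a second sample confirms the deviation with probability at least `1/2`
  have hsymm : μ {z | ∃ t, α < haussler ν (sampleMean (φ t) z) (trueMean (φ t) P)} ≤
      2 * μ.prod μ B := by
    refine measure_le_two_mul_prod μ μ fun z hz => ?_
    obtain ⟨t, ht⟩ := hz
    have hE := htrue t
    set E := trueMean (φ t) P
    have hc : 0 < α / 2 * (ν + E) := by positivity
    have hcheb : μ {z' | α / 2 * (ν + E) ≤ |sampleMean (φ t) z' - E|} ≤ 2⁻¹ := by
      refine (measure_le_abs_sampleMean_sub hn hm P (hφ' t) (hφM t) hc).trans ?_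
      rw [← ENNReal.ofReal_ofNat, ← ENNReal.ofReal_inv_of_pos two_pos]
      refine ENNReal.ofReal_le_ofReal ?_
      change M * E / (n * m) / _ ≤ _
      have h3 : 2 * M ≤ n * m * (α ^ 2 * ν) := (div_le_iff₀ (by positivity)).1 hnm
      have h4 : 4 * ν * E ≤ (ν + E) ^ 2 := by nlinarith [sq_nonneg (ν - E)]
      rw [div_div, div_le_iff₀ (by positivity)]
      calc M * E = 2 * M * E / 2 := by ring
        _ ≤ n * m * (α ^ 2 * ν) * E / 2 := by gcongr
        _ = n * m * α ^ 2 * (4 * ν * E) / 8 := by ring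
        _ ≤ n * m * α ^ 2 * (ν + E) ^ 2 / 8 := by gcongr
        _ = 2⁻¹ * (n * m * (α / 2 * (ν + E)) ^ 2) := by ring
    have hmeas : MeasurableSet {z' | α / 2 * (ν + E) ≤ |sampleMean (m := m) (φ t) z' - E|} := by
      have := (measurable_sampleMean_uncurry (m := m) hφ).comp (measurable_prodMk_left (x := t))
      exact measurableSet_le measurable_const (this.sub_const E).abs
    have hcompl : 2⁻¹ ≤ μ {z' | α / 2 * (ν + E) ≤ |sampleMean (φ t) z' - E|}ᶜ := by
      rw [prob_compl_eq_one_sub hmeas, ← ENNReal.one_sub_inv_two]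
      exact tsub_le_tsub_left hcheb _
    refine hcompl.trans (measure_mono fun z' hz' => ?_)
    rw [Set.mem_compl_iff, Set.mem_ofPred_eq, not_le] at hz'
    refine ⟨t, ?_⟩
    have h5 : haussler ν (sampleMean (φ t) z') E ≤ α / 2 := by
      rw [← not_lt, lt_haussler_iff hν (hmean t z') hE, not_lt]
      refine hz'.le.trans ?_
      have := hmean t z'
      gcongr
      linarith
    have h6 := haussler_triangle hν (hmean t z) (hmean t z') hE
    change α / 2 < haussler ν (sampleMean (φ t) z) (sampleMean (φ t) z')
    linarith
  -- random swaps of the two samples, and a union bound over the cover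
  have hswap : μ.prod μ B ≤
      ENNReal.ofReal (2 * K * Real.exp (-(α ^ 2 * ν * (n * m) / (8 * M)))) := by
    refine measure_le_of_card_le (fun σ => measurePreserving_swapSample P σ) hB
      (hcover.mono fun w hw => ?_)
    obtain ⟨F, hFK, hF⟩ := hw
    let bad : T → Finset (Fin n × Fin m → Bool) := fun t => {σ |
      α / 2 * (n * m * (ν / 4) + ∑ q : Fin n × Fin m,
        (φ t q.1 (w.1 q.1 q.2) + φ t q.1 (w.2 q.1 q.2))) <
      |∑ q : Fin n × Fin m, (if σ q then -(φ t q.1 (w.1 q.1 q.2) - φ t q.1 (w.2 q.1 q.2))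
        else φ t q.1 (w.1 q.1 q.2) - φ t q.1 (w.2 q.1 q.2))|}
    have hsub : ({σ | swapSample σ w ∈ B} : Finset (Fin n × Fin m → Bool)) ⊆ F.biUnion bad := by
      intro σ hσ
      obtain ⟨t, ht⟩ := (Finset.mem_filter.1 hσ).2
      rw [lt_haussler_iff hν (hmean t _) (hmean t _)] at ht
      obtain ⟨t', ht'F, ht'⟩ := hF t
      refine Finset.mem_biUnion.2 ⟨t', ht'F, ?_⟩
      rw [Finset.mem_filter]
      refine ⟨Finset.mem_univ _, ?_⟩
      rw [← sum_swapSample (fun i s => |φ t i s - φ t' i s|) σ w, Finset.sum_add_distrib] at ht'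
      have happ := add_le_add
        (abs_sampleMean_sub_le (φ t) (φ t') (swapSample σ w).1)
        (abs_sampleMean_sub_le (φ t) (φ t') (swapSample σ w).2)
      rw [← add_div] at happ
      have h := lt_abs_sub_of_approx hν hα₀ hα₁
        (happ.trans ((div_le_iff₀' hN).2 ht')) ht
      rw [sampleMean_swapSample_sub, abs_div, abs_of_pos hN, lt_div_iff₀ hN, add_assoc,
        sampleMean_eq, sampleMean_eq, ← add_div, ← Finset.sum_add_distrib,
        sum_swapSample (φ t')] at h
      refine lt_of_eq_of_lt ?_ h
      field_simp
    have hbad : ∀ t ∈ F, ((bad t).card : ℝ) ≤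
        2 * 2 ^ Fintype.card (Fin n × Fin m) *
          Real.exp (-(α ^ 2 * ν * (n * m) / (8 * M))) := fun t _ => by
      refine (card_swaps_le (a := fun q : Fin n × Fin m => φ t q.1 (w.1 q.1 q.2))
        (b := fun q => φ t q.1 (w.2 q.1 q.2)) hM (by positivity) (fun q => hφM _ _ _)
        fun q => hφM _ _ _).trans_eq ?_
      congr 3
      ring
    calc (Finset.card {σ | swapSample σ w ∈ B} : ℝ) ≤ ∑ t ∈ F, ((bad t).card : ℝ) := by
          exact_mod_cast (Finset.card_le_card hsub).trans Finset.card_biUnion_le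
      _ ≤ F.card • (2 * 2 ^ Fintype.card (Fin n × Fin m) *
          Real.exp (-(α ^ 2 * ν * (n * m) / (8 * M)))) := Finset.sum_le_card_nsmul _ _ _ hbad
      _ ≤ (K : ℝ) * (2 * 2 ^ Fintype.card (Fin n × Fin m) *
          Real.exp (-(α ^ 2 * ν * (n * m) / (8 * M)))) := by
          rw [nsmul_eq_mul]
          gcongr
      _ = _ := by
          rw [Fintype.card_fun, Fintype.card_bool]
          push_cast
          ring
  refine (hsymm.trans (mul_le_mul_right hswap 2)).trans_eq ?_
  rw [← ENNReal.ofReal_ofNat, ← ENNReal.ofReal_mul (by norm_num)]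
  congr 1
  ring

/-! ### Covers on finite sets of sample points -/

/-- The uniform distribution on a finite family of points. -/
noncomputable def empiricalMeasure {S ι : Type*} [MeasurableSpace S] [Fintype ι] (x : ι → S) :
    Measure S :=
  (Fintype.card ι : ℝ≥0∞)⁻¹ • ∑ i, Measure.dirac (x i)

section Covers

variable {S ι : Type*} [MeasurableSpace S] [Fintype ι]

instance [Nonempty ι] (x : ι → S) : IsProbabilityMeasure (empiricalMeasure x) where
  measure_univ := by
    simp [empiricalMeasure, ENNReal.inv_mul_cancel]

variable [MeasurableSingletonClass S]

theorem ae_empiricalMeasure {x : ι → S} {D : Set S} (hx : ∀ i, x i ∈ D) :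
    ∀ᵐ s ∂empiricalMeasure x, s ∈ D := by
  refine Measure.ae_smul_measure ?_ _
  rw [ae_iff, Measure.finsetSum_apply]
  refine Finset.sum_eq_zero fun i _ => ?_
  rw [← ae_iff, ae_dirac_eq]
  exact hx i

theorem lintegral_empiricalMeasure (x : ι → S) (f : S → ℝ≥0∞) :
    ∫⁻ s, f s ∂empiricalMeasure x = (Fintype.card ι : ℝ≥0∞)⁻¹ * ∑ i, f (x i) := by
  simp [empiricalMeasure, lintegral_finsetSum_measure]

theorem sum_le_of_lintegral_empiricalMeasure_le [Nonempty ι] {x : ι → S} {f : S → ℝ} {ε : ℝ}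
    (hf : ∀ s, 0 ≤ f s) (hε : 0 ≤ ε)
    (h : ∫⁻ s, ENNReal.ofReal (f s) ∂empiricalMeasure x ≤ ENNReal.ofReal ε) :
    ∑ i, f (x i) ≤ Fintype.card ι * ε := by
  have hcard : (Fintype.card ι : ℝ≥0∞) ≠ 0 := by simp
  rw [lintegral_empiricalMeasure, ← ENNReal.ofReal_sum_of_nonneg fun i _ => hf _,
    ENNReal.inv_mul_le_iff hcard (ENNReal.natCast_ne_top _), ← ENNReal.ofReal_natCast,
    ← ENNReal.ofReal_mul (Nat.cast_nonneg _), ENNReal.ofReal_le_ofReal_iff (by positivity)] at h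
  exact h

end Covers

theorem one_le_coverNumber {E : Type*} {ε : ℝ} {A : Set E} (hA : A.Nonempty) (d : E → E → ℝ≥0∞) :
    1 ≤ coverNumber ε A d := by
  refine le_iInf fun T => le_iInf fun hT => ?_
  obtain ⟨a, ha⟩ := hA
  obtain ⟨t, ht, -⟩ := hT.2 a ha
  exact Set.one_le_encard_iff_nonempty.2 ⟨t, ht⟩

theorem exists_finset_of_coverNumber_range_le {E I : Type*} {ε : ℝ} {u : I → E}
    {d : E → E → ℝ≥0∞} {K : ℕ} (h : coverNumber ε (Set.range u) d ≤ K) :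
    ∃ F : Finset I, F.card ≤ K ∧ ∀ a, ∃ b ∈ F, d (u a) (u b) ≤ ENNReal.ofReal ε := by
  classical
  have hlt : coverNumber ε (Set.range u) d < (K : ℕ∞) + 1 :=
    h.trans_lt (ENat.lt_add_one_iff (ENat.natCast_ne_top K) |>.2 le_rfl)
  simp only [coverNumber, iInf_lt_iff] at hlt
  obtain ⟨T, ⟨hTu, hT⟩, hTK⟩ := hlt
  have hTK' : T.encard ≤ K := (ENat.lt_add_one_iff (ENat.natCast_ne_top K)).1 hTK
  have hfin : T.Finite := Set.finite_of_encard_le_coe hTK'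
  lift T to Finset E using hfin
  rw [Set.encard_coe_eq_coe_finsetCard, Nat.cast_le] at hTK'
  choose v hv using fun e : T => hTu e.2
  refine ⟨T.attach.image v, Finset.card_image_le.trans (by rwa [Finset.card_attach]), fun a => ?_⟩
  obtain ⟨t, ht, hd⟩ := hT (u a) ⟨a, rfl⟩
  exact ⟨v ⟨t, ht⟩, Finset.mem_image_of_mem v (Finset.mem_attach _ _), by rwa [hv]⟩

section Tasks

variable {X W Y Θ : Type*}

/-- The losses of the `n` networks with the common weights `t.1` and the task parameters `t.2 i`. -/
def taskLoss {ι : Type*} (l : Y → Y → ℝ) (g : X × W → Θ → Y) (t : Θ × (ι → W)) (i : ι) :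
    X × Y → ℝ :=
  lossFun l fun x => g (x, t.2 i) t.1

theorem paramMaps_eq_range : paramMaps X W = Set.range fun (p : W) (x : X) => (x, p) := by
  ext f
  simp [paramMaps, eq_comm]

theorem lossClass_networkClass_eq_range {V : Type*} (l : Y → Y → ℝ) (g : V → Θ → Y) :
    lossClass l (networkClass g) = Set.range fun θ => lossFun l fun v => g v θ := by
  ext f
  simp [lossClass, networkClass, eq_comm]

/-- On finitely many sample points, the losses of all tuples of networks have a cover whose size is
bounded by the capacities: cover the parameters of each task with respect to the points of that task,
uniformly in the weights, and then, for each tuple of parameters in the covers, cover the weights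
with respect to all points. -/
theorem exists_finset_taskLoss_cover [MeasurableSpace X] [MeasurableSpace Y] [MeasurableSpace W]
    [MeasurableSingletonClass X] [MeasurableSingletonClass Y] [MeasurableSingletonClass W]
    {ι κ : Type*} [Fintype ι] [Fintype κ] [Nonempty ι] [Nonempty κ] {Z : Set (X × Y)}
    {l : Y → Y → ℝ} {g : X × W → Θ → Y} {ε₁ ε₂ : ℝ} (hε₁ : 0 ≤ ε₁) (hε₂ : 0 ≤ ε₂) {K₁ K₂ : ℕ}
    (hK₁ : supCapacity Z l (networkClass g) ε₁ (paramMaps X W) ≤ K₁)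
    (hK₂ : capacity (extendedDomain W Z) ε₂ (lossClass l (networkClass g)) ≤ K₂)
    (x : ι → κ → X × Y) (hx : ∀ i k, x i k ∈ Z) :
    ∃ F : Finset (Θ × (ι → W)), F.card ≤ K₁ ^ Fintype.card ι * K₂ ∧ ∀ t, ∃ t' ∈ F,
      ∑ i, ∑ k, |taskLoss l g t i (x i k) - taskLoss l g t' i (x i k)| ≤
        Fintype.card ι * Fintype.card κ * (ε₁ + ε₂) := by
  classical
  have h₁ : ∀ i, ∃ F : Finset W, F.card ≤ K₁ ∧ ∀ p, ∃ p' ∈ F, ∀ θ,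
      ∑ k, |lossFun l (fun u => g (u, p) θ) (x i k) - lossFun l (fun u => g (u, p') θ) (x i k)| ≤
        Fintype.card κ * ε₁ := by
    intro i
    have h : coverNumber ε₁ (paramMaps X W)
        (distSup l (networkClass g) (empiricalMeasure (x i))) ≤ K₁ :=
      (le_iSup₂_of_le (empiricalMeasure (x i)) ⟨inferInstance, ae_empiricalMeasure (hx i)⟩
        le_rfl).trans hK₁
    rw [paramMaps_eq_range] at h
    obtain ⟨F, hFK, hF⟩ := exists_finset_of_coverNumber_range_le h
    refine ⟨F, hFK, fun p => ?_⟩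
    obtain ⟨p', hp', hd⟩ := hF p
    refine ⟨p', hp', fun θ => ?_⟩
    refine sum_le_of_lintegral_empiricalMeasure_le (f := fun s =>
      |lossFun l (fun u => g (u, p) θ) s - lossFun l (fun u => g (u, p') θ) s|)
      (fun _ => abs_nonneg _) hε₁ (le_trans (lintegral_mono fun s => ?_) hd)
    exact le_iSup₂_of_le (f := fun (h : X × W → Y) (_ : h ∈ networkClass g) => ENNReal.ofReal
      |lossFun l (h ∘ fun u => (u, p)) s - lossFun l (h ∘ fun u => (u, p')) s|)
      (fun v => g v θ) ⟨θ, rfl⟩ le_rfl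
  choose F₁ hF₁K hF₁ using h₁
  have h₂ : ∀ p : ι → W, ∃ F : Finset Θ, F.card ≤ K₂ ∧ ∀ θ, ∃ θ' ∈ F,
      ∑ i, ∑ k, |taskLoss l g (θ, p) i (x i k) - taskLoss l g (θ', p) i (x i k)| ≤
        Fintype.card ι * Fintype.card κ * ε₂ := by
    intro p
    let y : ι × κ → (X × W) × Y := fun q => (((x q.1 q.2).1, p q.1), (x q.1 q.2).2)
    have h : coverNumber ε₂ (lossClass l (networkClass g)) (distL1 (empiricalMeasure y)) ≤ K₂ :=
      (le_iSup₂_of_le (empiricalMeasure y)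
        ⟨inferInstance, ae_empiricalMeasure fun q => hx q.1 q.2⟩ le_rfl).trans hK₂
    rw [lossClass_networkClass_eq_range] at h
    obtain ⟨F, hFK, hF⟩ := exists_finset_of_coverNumber_range_le h
    refine ⟨F, hFK, fun θ => ?_⟩
    obtain ⟨θ', hθ', hd⟩ := hF θ
    refine ⟨θ', hθ', ?_⟩
    have := sum_le_of_lintegral_empiricalMeasure_le (fun _ => abs_nonneg _) hε₂ hd
    rw [Fintype.card_prod, Nat.cast_mul, Fintype.sum_prod_type] at this
    exact this
  choose F₂ hF₂K hF₂ using h₂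
  refine ⟨(Fintype.piFinset F₁).biUnion fun p => (F₂ p).image fun θ => (θ, p), ?_, ?_⟩
  · refine (Finset.card_biUnion_le_card_mul _ _ K₂ fun p _ =>
      Finset.card_image_le.trans (hF₂K p)).trans ?_
    gcongr
    rw [Fintype.card_piFinset]
    exact Finset.prod_le_pow_card _ _ _ fun i _ => hF₁K i
  · rintro ⟨θ, p⟩
    choose p' hp'F hp' using fun i => hF₁ i (p i)
    obtain ⟨θ', hθ'F, hθ'⟩ := hF₂ p' θ
    refine ⟨(θ', p'), Finset.mem_biUnion.2 ⟨p', Fintype.mem_piFinset.2 hp'F,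
      Finset.mem_image_of_mem _ hθ'F⟩, ?_⟩
    calc ∑ i, ∑ k, |taskLoss l g (θ, p) i (x i k) - taskLoss l g (θ', p') i (x i k)|
        ≤ ∑ i, ∑ k, (|taskLoss l g (θ, p) i (x i k) - taskLoss l g (θ, p') i (x i k)| +
            |taskLoss l g (θ, p') i (x i k) - taskLoss l g (θ', p') i (x i k)|) := by
          gcongr
          exact abs_sub_le _ _ _
      _ ≤ ∑ _i : ι, Fintype.card κ * ε₁ + Fintype.card ι * Fintype.card κ * ε₂ := by
          simp only [Finset.sum_add_distrib]
          gcongr with i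
          exact hp' i θ
      _ = _ := by
          rw [Finset.sum_const, Finset.card_univ, nsmul_eq_mul]
          ring

theorem one_le_supCapacity [MeasurableSpace X] [MeasurableSpace Y] {Z : Set (X × Y)}
    (P : Measure (X × Y)) [IsProbabilityMeasure P] (hP : ∀ᵐ z ∂P, z ∈ Z) (l : Y → Y → ℝ)
    {V : Type*} (G : Set (V → Y)) (ε : ℝ) {F : Set (X → V)} (hF : F.Nonempty) :
    1 ≤ supCapacity Z l G ε F :=
  le_iSup₂_of_le (f := fun (P : Measure (X × Y)) (_ : IsProbabilityMeasure P ∧ ∀ᵐ z ∂P, z ∈ Z) =>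
    coverNumber ε F (distSup l G P)) P ⟨inferInstance, hP⟩ (one_le_coverNumber hF _)

theorem one_le_capacity {S : Type*} [MeasurableSpace S] [MeasurableSingletonClass S] {D : Set S}
    (hD : D.Nonempty) (ε : ℝ) {H : Set (S → ℝ)} (hH : H.Nonempty) : 1 ≤ capacity D ε H := by
  obtain ⟨s, hs⟩ := hD
  refine le_iSup₂_of_le (f := fun (P : Measure S)
    (_ : IsProbabilityMeasure P ∧ ∀ᵐ z ∂P, z ∈ D) => coverNumber ε H (distL1 P))
    (Measure.dirac s) ⟨inferInstance, ?_⟩ (one_le_coverNumber hH _)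
  rw [ae_dirac_eq]
  exact hs

end Tasks

/-! ### The sample size -/

/-- The sample size condition: it forces finite capacities, and makes the failure probability at
most `δ`. -/
theorem capacity_bound_of_sampleSize {C₁ C₂ : ℕ∞} (hC₁ : 1 ≤ C₁) (hC₂ : 1 ≤ C₂) {c δ : ℝ}
    (hc : 0 < c) (hδ₀ : 0 < δ) (hδ₁ : δ < 1) {n m : ℕ} (hn : 0 < n)
    (h : (c : EReal) * (ENNReal.log (C₁ : ℝ≥0∞) + ((1 / (n : ℝ) : ℝ) : EReal) *
      ENNReal.log (4 * (C₂ : ℝ≥0∞) / ENNReal.ofReal δ)) < ((m : ℝ) : EReal)) :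
    ∃ K₁ K₂ : ℕ, C₁ = K₁ ∧ C₂ = K₂ ∧
      c * Real.log (4 * (K₁ ^ n * K₂ : ℕ) / δ) < n * m ∧ 1 ≤ K₁ ^ n * K₂ := by
  have hn' : (0 : ℝ) < 1 / n := by positivity
  have hlog₁ : 0 ≤ ENNReal.log (C₁ : ℝ≥0∞) := by
    rw [ENNReal.zero_le_log_iff]
    exact_mod_cast hC₁
  have hlog₂ : 0 ≤ ENNReal.log (4 * (C₂ : ℝ≥0∞) / ENNReal.ofReal δ) := by
    rw [ENNReal.zero_le_log_iff, ENNReal.le_div_iff_mul_le (by simp [hδ₀]) (by simp), one_mul]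
    have h1 : (1 : ℝ≥0∞) ≤ C₂ := by exact_mod_cast hC₂
    calc ENNReal.ofReal δ ≤ 1 := by simpa using hδ₁.le
      _ ≤ 4 * (C₂ : ℝ≥0∞) := one_le_mul (by norm_num) h1
  have hne₁ : C₁ ≠ ⊤ := by
    rintro rfl
    rw [ENat.toENNReal_top, ENNReal.log_top, EReal.top_add_of_ne_bot, EReal.coe_mul_top_of_pos hc]
      at h
    · exact not_top_lt h
    · exact (lt_of_lt_of_le EReal.bot_lt_zero
        (mul_nonneg (by exact_mod_cast hn'.le) hlog₂)).ne'
  have hne₂ : C₂ ≠ ⊤ := by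
    rintro rfl
    rw [ENat.toENNReal_top, ENNReal.mul_top (by norm_num),
      ENNReal.top_div_of_ne_top ENNReal.ofReal_ne_top, ENNReal.log_top,
      EReal.coe_mul_top_of_pos hn', EReal.add_top_of_ne_bot, EReal.coe_mul_top_of_pos hc] at h
    · exact not_top_lt h
    · exact (lt_of_lt_of_le EReal.bot_lt_zero hlog₁).ne'
  lift C₁ to ℕ using hne₁ with K₁
  lift C₂ to ℕ using hne₂ with K₂
  have hK₁ : 1 ≤ K₁ := by exact_mod_cast hC₁
  have hK₂ : 1 ≤ K₂ := by exact_mod_cast hC₂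
  refine ⟨K₁, K₂, rfl, rfl, ?_, Nat.one_le_iff_ne_zero.2 (by positivity)⟩
  have hK₁' : (0 : ℝ) < K₁ := by exact_mod_cast hK₁
  have hK₂' : (0 : ℝ) < K₂ := by exact_mod_cast hK₂
  have e₁ : ((K₁ : ℕ∞) : ℝ≥0∞) = ENNReal.ofReal K₁ := by simp
  have e₂ : 4 * ((K₂ : ℕ∞) : ℝ≥0∞) / ENNReal.ofReal δ = ENNReal.ofReal (4 * K₂ / δ) := by
    rw [ENNReal.ofReal_div_of_pos hδ₀, ENNReal.ofReal_mul (by norm_num)]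
    simp
  rw [e₁, e₂, ENNReal.log_ofReal_of_pos hK₁', ENNReal.log_ofReal_of_pos (by positivity)] at h
  have h' : c * (Real.log K₁ + 1 / n * Real.log (4 * K₂ / δ)) < m := by exact_mod_cast h
  have hlog : Real.log (4 * (K₁ ^ n * K₂ : ℕ) / δ) =
      n * (Real.log K₁ + 1 / n * Real.log (4 * K₂ / δ)) := by
    have : (4 * (K₁ ^ n * K₂ : ℕ) / δ : ℝ) = K₁ ^ n * (4 * K₂ / δ) := by
      push_cast
      ring
    rw [this, Real.log_mul (by positivity) (by positivity), Real.log_pow]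
    field_simp
  rw [hlog]
  calc c * (n * (Real.log K₁ + 1 / n * Real.log (4 * K₂ / δ)))
      = n * (c * (Real.log K₁ + 1 / n * Real.log (4 * K₂ / δ))) := by ring
    _ < n * m := by gcongr

/-! ### The multi-task bound -/

theorem theorem1
    {k₁ k₂ d : ℕ}
    -- the sample space and the bounded loss function
    (Z : Set (EuclideanSpace ℝ (Fin k₁) × EuclideanSpace ℝ (Fin k₂)))
    (M : ℝ) (hM : 0 < M)
    (l : EuclideanSpace ℝ (Fin k₂) → EuclideanSpace ℝ (Fin k₂) → ℝ)
    (hl : Measurable (Function.uncurry l))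
    (hlM : ∀ y y', l y y' ∈ Set.Icc 0 M)
    -- the parameterized network `g((x, p); θ)` with weights `θ`
    {Θ : Type*} [MeasurableSpace Θ] [StandardBorelSpace Θ]
    (g : EuclideanSpace ℝ (Fin k₁) × EuclideanSpace ℝ (Fin d) → Θ → EuclideanSpace ℝ (Fin k₂))
    (hg : Measurable (Function.uncurry g))
    (ν α ε₁ ε₂ δ : ℝ) (hν : 0 < ν) (hα₀ : 0 < α) (hα₁ : α < 1)
    (hε₁ : 0 < ε₁) (hε₂ : 0 < ε₂) (hε : ε₁ + ε₂ = α * ν / 8)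
    (hδ₀ : 0 < δ) (hδ₁ : δ < 1)
    -- `n` tasks with their distributions on `Z`, and `m` samples for each task
    (n m : ℕ) (hn : 1 ≤ n)
    (P : Fin n → Measure (EuclideanSpace ℝ (Fin k₁) × EuclideanSpace ℝ (Fin k₂)))
    [∀ i, IsProbabilityMeasure (P i)]
    (hP : ∀ i, ∀ᵐ z ∂(P i), z ∈ Z)
    (hm : ((8 * M / (α ^ 2 * ν) : ℝ) : EReal) *
        (ENNReal.log
            ((supCapacity Z l (networkClass g) ε₁
              (paramMaps (EuclideanSpace ℝ (Fin k₁)) (EuclideanSpace ℝ (Fin d))) : ℕ∞) : ℝ≥0∞)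
          + ((1 / (n : ℝ) : ℝ) : EReal) *
            ENNReal.log
              (4 * ((capacity (extendedDomain (EuclideanSpace ℝ (Fin d)) Z) ε₂
                (lossClass l (networkClass g)) : ℕ∞) : ℝ≥0∞) / ENNReal.ofReal δ))
      < ((m : ℝ) : EReal)) :
    Measure.pi (fun i : Fin n => Measure.pi (fun _ : Fin m => P i))
        {z | ∃ h ∈ compClass (diagClass n (networkClass g))
              (powClass n (paramMaps (EuclideanSpace ℝ (Fin k₁)) (EuclideanSpace ℝ (Fin d)))),
            α < haussler ν (multiEmpLoss l h z) (multiTrueLoss l h P)}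
      ≤ ENNReal.ofReal δ := by
  -- the members of `𝓖̄ ∘ 𝓕ⁿ` are given by the weights and `n` task parameters
  have hset : {z : Fin n → Fin m → _ | ∃ h ∈ compClass (diagClass n (networkClass g))
        (powClass n (paramMaps (EuclideanSpace ℝ (Fin k₁)) (EuclideanSpace ℝ (Fin d)))),
        α < haussler ν (multiEmpLoss l h z) (multiTrueLoss l h P)} ⊆
      {z | ∃ t : Θ × (Fin n → EuclideanSpace ℝ (Fin d)),
        α < haussler ν (sampleMean (taskLoss l g t) z) (trueMean (taskLoss l g t) P)} := by
    rintro z ⟨h, ⟨k, ⟨_, ⟨θ, rfl⟩, rfl⟩, f, hf, rfl⟩, hz⟩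
    choose p hp using hf
    obtain rfl : f = fun i x => (x, p i) := funext hp
    exact ⟨(θ, p), hz⟩
  refine (measure_mono hset).trans ?_
  rcases isEmpty_or_nonempty Θ with hΘ | ⟨⟨θ₀⟩⟩
  · simp
  let i₀ : Fin n := ⟨0, hn⟩
  obtain ⟨z₀, hz₀⟩ := (hP i₀).exists
  have hn' : (0 : ℝ) < n := by positivity
  have hF : (paramMaps (EuclideanSpace ℝ (Fin k₁)) (EuclideanSpace ℝ (Fin d))).Nonempty :=
    ⟨_, 0, rfl⟩
  have hG : (lossClass l (networkClass g)).Nonempty := ⟨_, _, ⟨θ₀, rfl⟩, rfl⟩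
  have hD : (extendedDomain (EuclideanSpace ℝ (Fin d)) Z).Nonempty := ⟨((z₀.1, 0), z₀.2), hz₀⟩
  obtain ⟨K₁, K₂, hK₁, hK₂, hnm, hK⟩ := capacity_bound_of_sampleSize
    (one_le_supCapacity (P i₀) (hP i₀) l (networkClass g) ε₁ hF)
    (one_le_capacity hD ε₂ hG) (by positivity) hδ₀ hδ₁ hn hm
  set K := K₁ ^ n * K₂ with hKdef
  have hK' : (1 : ℝ) ≤ K := by exact_mod_cast hK
  have hc : 0 < 8 * M / (α ^ 2 * ν) := by positivity
  -- `log (4 K / δ) ≥ log 4 ≥ 1/4`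
  have hlog : 1 / 4 ≤ Real.log (4 * K / δ) := by
    have h1 : 4 ≤ 4 * K / δ := by
      rw [le_div_iff₀ hδ₀]
      nlinarith
    have h2 := Real.one_sub_inv_le_log_of_pos (show 0 < 4 * K / δ by positivity)
    have h3 := inv_anti₀ four_pos h1
    linarith
  have hnm' : 2 * M / (α ^ 2 * ν) ≤ n * m := by
    refine le_trans ?_ hnm.le
    calc 2 * M / (α ^ 2 * ν) = 8 * M / (α ^ 2 * ν) * (1 / 4) := by ring
      _ ≤ _ := by gcongr
  have hm0 : 0 < m := by
    have h1 : 0 < (n : ℝ) * m := lt_of_lt_of_le (by positivity) hnm'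
    exact_mod_cast pos_of_mul_pos_right h1 hn'.le
  have : Nonempty (Fin n) := ⟨i₀⟩
  have : Nonempty (Fin m) := ⟨⟨0, hm0⟩⟩
  have hmeas : ∀ i : Fin n, Measurable fun q : (Θ × (Fin n → EuclideanSpace ℝ (Fin d))) ×
      (EuclideanSpace ℝ (Fin k₁) × EuclideanSpace ℝ (Fin k₂)) => taskLoss l g q.1 i q.2 := by
    intro i
    have h1 : Measurable fun q : (Θ × (Fin n → EuclideanSpace ℝ (Fin d))) ×
        (EuclideanSpace ℝ (Fin k₁) × EuclideanSpace ℝ (Fin k₂)) =>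
        ((q.2.1, q.1.2 i), q.1.1) := by fun_prop
    have h2 := hg.comp h1
    exact hl.comp (measurable_snd.snd.prodMk h2)
  refine (measure_exists_lt_haussler_le (K := K) hn hm0 P hmeas hM (fun _ _ _ => hlM _ _) hν hα₀
    hα₁ hnm' ?_).trans (ENNReal.ofReal_le_ofReal ?_)
  · have hZ : ∀ᵐ z ∂(Measure.pi fun i : Fin n => Measure.pi fun _ : Fin m => P i),
        ∀ i j, z i j ∈ Z :=
      ae_all_iff.2 fun i => ae_all_iff.2 fun j =>
        (measurePreserving_eval (fun i => Measure.pi fun _ : Fin m => P i)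
          i).quasiMeasurePreserving.ae ((measurePreserving_eval (fun _ : Fin m => P i) j).quasiMeasurePreserving.ae (hP i))
    filter_upwards [Measure.quasiMeasurePreserving_fst.ae hZ,
      Measure.quasiMeasurePreserving_snd.ae hZ] with w hw₁ hw₂
    obtain ⟨F, hFK, hF⟩ := exists_finset_taskLoss_cover hε₁.le hε₂.le hK₁.le hK₂.le
      (fun (i : Fin n) => Sum.elim (w.1 i) (w.2 i)) (by
        rintro i (j | j)
        exacts [hw₁ i j, hw₂ i j])
    refine ⟨F, by simpa using hFK, fun t => ?_⟩
    obtain ⟨t', ht', h⟩ := hF t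
    refine ⟨t', ht', ?_⟩
    simp only [Fintype.sum_sum_type, Sum.elim_inl, Sum.elim_inr, Fintype.card_sum,
      Fintype.card_fin, hε] at h
    simp only [Fintype.sum_prod_type, Finset.sum_add_distrib] at h ⊢
    refine h.trans_eq ?_
    push_cast
    ring
  · have h1 : Real.log (4 * K / δ) ≤ α ^ 2 * ν * (n * m) / (8 * M) := by
      rw [le_div_iff₀ (by positivity)]
      rw [div_mul_eq_mul_div, div_lt_iff₀ (by positivity)] at hnm
      linarith
    calc 4 * K * Real.exp (-(α ^ 2 * ν * (n * m) / (8 * M)))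
        ≤ 4 * K * Real.exp (-Real.log (4 * K / δ)) := by gcongr
      _ = δ := by
        rw [Real.exp_neg, Real.exp_log (by positivity)]
        field_simp
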